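/- Let $k\geq 1$ be an integer, let $\mathbb{T}^2=\mathbb{R}^2/\mathbb{Z}^2$, and let $\tau\colon \mathbb{T}^2\to\mathbb{T}^2$ be the map $\tau(a,b)=(-a,\,a+b+\tfrac{1}{4k})$. Let $\mathbb{K}^2$ be the Klein bottle, the quotient $g\colon\mathbb{T}^2\to\mathbb{K}^2$ of the torus by the identification $(a,b)\sim(-a,b+\tfrac12)$. With base points $(0,0)$ and $g(0,0)$, let $x,y\in\pi_1(\mathbb{T}^2)$ be the classes of the loops $t\mapsto(t,0)$ and $t\mapsto(0,t)$, and let $u,v\in\pi_1(\mathbb{K}^2)$ be the classes of the loops $t\mapsto g(t,0)$ and $t\mapsto g(0,t/2)$, where $t\in[0,1]$. 1. There is a continuous free action of $\mathbb{Z}_{4k}$ on $\mathbb{T}^2$ whose generator $\overline{1}$ acts by $\tau$. 2. The orbit space $\mathbb{T}^2_\tau$ is homeomorphic to $\mathbb{K}^2$. The homeomorphism can be chosen so that its composition $p_\tau\colon\mathbb{T}^2\to\mathbb{K}^2$ with the orbit projection is a covering map, the quotient by the action of $\mathbb{Z}_{4k}$, with $p_\tau(0,0)=g(0,0)$, for which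 the following holds. Let $\theta_\tau\colon\pi_1(\mathbb{K}^2)\to\mathbb{Z}_{4k}$ send the class of a loop to the element $\overline{\imath}$ such that the lift of the loop starting at $(0,0)$ ends at $\tau^i(0,0)$. Then $\pi_1(\mathbb{T}^2)=\langle x,y\mid xyx^{-1}y^{-1}=1\rangle$, $\pi_1(\mathbb{K}^2)=\langle u,v\mid uvuv^{-1}=1\rangle$, the sequence $$1\longrightarrow \pi_1(\mathbb{T}^2)\xrightarrow{(p_\tau)_\#}\pi_1(\mathbb{K}^2)\xrightarrow{\theta_\tau}\mathbb{Z}_{4k}\longrightarrow 1$$ is exact, and $$(p_\tau)_\#(x)=uv^{2k},\qquad (p_\tau)_\#(y)=v^{4k},\qquad \theta_\tau(u)=\overline{2k},\qquad \theta_\tau(v)=\overline{1}.$$ 3. The quadruple $(\mathbb{T}^2,\mathbb{Z}_{4k},\tau;\mathbb{R}^2)$ does not have the Borsuk-Ulam property. That is, it is not true that for every homotopy class of maps $\mathbb{T}^2\to\mathbb{R}^2$ and every map $f$ in that class there are $z\in\mathbb{T}^2$ and distinct $\overline{\imath},\overline{\jmath}\in\mathbb{Z}_{4k}$ with $f(\tau^i(z))=f(\tau^j(z))$.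 Explicitly, the formula $$h(a,b)=\bigl(r(a)\cos 2\pi b,\ r(a)\sin 2\pi b\bigr)\quad(0\le a,b\le 1),\qquad r(a)=\begin{cases}(3-4a)/2 & 0\le a\le \frac14,\\ (1+4a)/2 & \frac14\le a\le\frac34,\\ (7-4a)/2 & \frac34\le a\le 1,\end{cases}$$ gives a well-defined continuous map $h\colon\mathbb{T}^2\to\mathbb{R}^2$ that is injective on every orbit of the action. -/

import Mathlib

open scoped Topology

/-- A group `G` is presented by the generators `gens` and the relators `rels`: the canonical
homomorphism from the free group is onto, and its kernel is the normal closure of the relators. -/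
def IsPresentedBy {G : Type*} [Group G] {ι : Type*} (gens : ι → G)
    (rels : Set (FreeGroup ι)) : Prop :=
  Function.Surjective (FreeGroup.lift gens) ∧
    (FreeGroup.lift gens).ker = Subgroup.normalClosure rels

section Actions

variable (G : Type*) [Group G] (M : Type*) [MulAction G M]

/-- The action is free: only the identity has fixed points. -/
def IsFreeAction : Prop := ∀ (g : G) (x : M), g • x = x → g = 1

variable [TopologicalSpace M]

/-- The orbit space of the action, with the quotient topology. -/
abbrev OrbitSpace : Type _ := Quotient (MulAction.orbitRel G M)

/-- The natural projection onto the orbit space. -/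
def orbitProj : C(M, OrbitSpace G M) := ⟨Quotient.mk (MulAction.orbitRel G M), continuous_quotient_mk'⟩

/-- The homotopy class `β ∈ [M, N]` has the Borsuk-Ulam property with respect to the action of `G`:
every representative identifies two points of an orbit indexed by different group elements. -/
def ClassHasBorsukUlam {N : Type*} [TopologicalSpace N]
    (β : Quotient (⟨ContinuousMap.Homotopic, ContinuousMap.Homotopic.equivalence⟩ :
      Setoid C(M, N))) : Prop :=
  ∀ f : C(M, N), Quotient.mk _ f = β →
    ∃ g₁ g₂ : G, g₁ ≠ g₂ ∧ ∃ x : M, f (g₁ • x) = f (g₂ • x)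

/-- The quadruple `(M, G, action; N)` has the Borsuk-Ulam property: every free homotopy class of
maps from `M` to `N` has it. -/
def HasBorsukUlam (N : Type*) [TopologicalSpace N] : Prop :=
  ∀ β : Quotient (⟨ContinuousMap.Homotopic, ContinuousMap.Homotopic.equivalence⟩ :
    Setoid C(M, N)), ClassHasBorsukUlam G M β

end Actions

/-- The homomorphism `θ : π₁(X, x) → G` attached to a covering `p : M → X` that is the quotient by
an action of an abelian group `G`, with base point `e` over `x`: the class of a loop `γ` is
sent to the `g ∈ G` such that the lift of `γ` starting at `e` ends at `g • e`.
(It identifies `π₁(X, x) / p_#(π₁(M, e))` with `G` when `M` is path connected. As `G` is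
abelian, passing between `G` and its opposite group is harmless.) -/
noncomputable def deckHom {M X G : Type*} [TopologicalSpace M] [TopologicalSpace X]
    [CommGroup G] [MulAction G M] {p : M → X} (hp : IsQuotientCoveringMap p G)
    {x : X} (e : p ⁻¹' {x}) : FundamentalGroup X x →* G :=
  (MulOpposite.opMulEquiv (M := G)).symm.toMonoidHom.comp (hp.fundamentalGroupToMulOpposite e)

/-- The torus `ℝ²/ℤ² = ℝ/ℤ × ℝ/ℤ`. -/
abbrev Torus : Type := UnitAddCircle × UnitAddCircle

namespace Torus

/-- The image in the torus of the point `(a, b)` of the plane. -/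
def pt (a b : ℝ) : Torus := ((a : UnitAddCircle), (b : UnitAddCircle))

/-- The map `τ(a, b) = (-a, a + b + 1/(4k))`. -/
noncomputable def tau (k : ℕ) (z : Torus) : Torus :=
  (-z.1, z.1 + z.2 + ((1 / (4 * (k : ℝ)) : ℝ) : UnitAddCircle))

lemma continuous_pt {f g : unitInterval → ℝ} (hf : Continuous f) (hg : Continuous g) :
    Continuous fun t => pt (f t) (g t) :=
  ((AddCircle.continuous_mk' 1).comp hf).prodMk ((AddCircle.continuous_mk' 1).comp hg)

lemma coe_one : ((1 : ℝ) : UnitAddCircle) = 0 := AddCircle.coe_period 1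

/-- The loop `t ↦ (t, 0)`. -/
def loopX : Path (pt 0 0) (pt 0 0) where
  toFun t := pt (t : ℝ) 0
  continuous_toFun := continuous_pt continuous_subtype_val continuous_const
  source' := by simp
  target' := by simp [pt, coe_one]

/-- The loop `t ↦ (0, t)`. -/
def loopY : Path (pt 0 0) (pt 0 0) where
  toFun t := pt 0 (t : ℝ)
  continuous_toFun := continuous_pt continuous_const continuous_subtype_val
  source' := by simp
  target' := by simp [pt, coe_one]

/-- The class of `t ↦ (t, 0)` in the fundamental group. -/
def x : FundamentalGroup Torus (pt 0 0) := FundamentalGroup.fromPath (.mk loopX)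

/-- The class of `t ↦ (0, t)` in the fundamental group. -/
def y : FundamentalGroup Torus (pt 0 0) := FundamentalGroup.fromPath (.mk loopY)

/-- The free involution `(a, b) ↦ (-a, b + 1/2)`. -/
noncomputable def kleinInvolution (z : Torus) : Torus :=
  (-z.1, z.2 + ((1 / 2 : ℝ) : UnitAddCircle))

lemma kleinInvolution_kleinInvolution (z : Torus) :
    kleinInvolution (kleinInvolution z) = z := by
  have h : ((1 / 2 : ℝ) : UnitAddCircle) + ((1 / 2 : ℝ) : UnitAddCircle) = 0 := by
    rw [← AddCircle.coe_add, add_halves, coe_one]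
  ext <;> simp only [kleinInvolution, neg_neg, add_assoc, h, add_zero]

/-- Two points are equivalent if they agree up to the involution `(a, b) ↦ (-a, b + 1/2)`. -/
def kleinSetoid : Setoid Torus where
  r z w := z = w ∨ z = kleinInvolution w
  iseqv :=
    { refl := fun _ => Or.inl rfl
      symm := by
        rintro z w (rfl | rfl)
        · exact Or.inl rfl
        · exact Or.inr (kleinInvolution_kleinInvolution w).symm
      trans := by
        rintro a b c (rfl | rfl) (rfl | rfl)
        · exact Or.inl rfl
        · exact Or.inr rfl
        · exact Or.inr rfl
        · exact Or.inl (kleinInvolution_kleinInvolution c) }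

end Torus

/-- The Klein bottle: the quotient of the torus by `(a, b) ~ (-a, b + 1/2)`. -/
abbrev KleinBottle : Type := Quotient Torus.kleinSetoid

namespace KleinBottle

/-- The image `g(a, b)` in the Klein bottle of the point `(a, b)` of the plane. -/
def pt (a b : ℝ) : KleinBottle := Quotient.mk Torus.kleinSetoid (Torus.pt a b)

/-- The loop `t ↦ g(t, 0)`. -/
def loopU : Path (pt 0 0) (pt 0 0) where
  toFun t := pt (t : ℝ) 0
  continuous_toFun := continuous_quotient_mk'.comp
    (Torus.continuous_pt continuous_subtype_val continuous_const)
  source' := by simp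
  target' := by simp [pt, Torus.pt, Torus.coe_one]

lemma pt_zero_half : pt 0 (1 / 2) = pt 0 0 :=
  Quotient.sound (s := Torus.kleinSetoid)
    (Or.inr (by ext <;> simp [Torus.pt, Torus.kleinInvolution]))

/-- The loop `t ↦ g(0, t/2)`. -/
noncomputable def loopV : Path (pt 0 0) (pt 0 0) where
  toFun t := pt 0 ((t : ℝ) / 2)
  continuous_toFun := continuous_quotient_mk'.comp
    (Torus.continuous_pt continuous_const (continuous_subtype_val.div_const 2))
  source' := by simp
  target' := by simpa using pt_zero_half

/-- The class of `t ↦ g(t, 0)` in the fundamental group. -/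
def u : FundamentalGroup KleinBottle (pt 0 0) := FundamentalGroup.fromPath (.mk loopU)

/-- The class of `t ↦ g(0, t/2)` in the fundamental group. -/
noncomputable def v : FundamentalGroup KleinBottle (pt 0 0) :=
  FundamentalGroup.fromPath (.mk loopV)

end KleinBottle

/-- The relator `x y x⁻¹ y⁻¹` in the free group on `x, y` (numbered `0, 1`). -/
def torusRelator : FreeGroup (Fin 2) :=
  FreeGroup.of 0 * FreeGroup.of 1 * (FreeGroup.of 0)⁻¹ * (FreeGroup.of 1)⁻¹

/-- The relator `u v u v⁻¹` in the free group on `u, v` (numbered `0, 1`). Mathlib multiplies loops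
in the opposite order to the usual one; reversing the order turns this relator into a conjugate
of itself, and `u` commutes with `v²`, so all formulas below hold in either convention. -/
def kleinRelator : FreeGroup (Fin 2) :=
  FreeGroup.of 0 * FreeGroup.of 1 * FreeGroup.of 0 * (FreeGroup.of 1)⁻¹

/-- The radius function on `[0, 1]`. -/
noncomputable def radius (a : ℝ) : ℝ :=
  if a ≤ 1 / 4 then (3 - 4 * a) / 2
  else if a ≤ 3 / 4 then (1 + 4 * a) / 2
  else (7 - 4 * a) / 2

/-! Everything is read off in the plane. The linear automorphism `e(a, b) = (a, ka + 2kb)`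
conjugates the lift `(a, b) ↦ (-a, a + b + 1/(4k))` of `τ` to `(a, b) ↦ (-a, b + 1/2)`, the deck
transformation of the plane over the Klein bottle that corresponds to `v`. It also carries the deck
group `ℤ²` of the torus into that of the Klein bottle. So `e` descends to `toKlein`, whose fibres
are exactly the orbits of `τ` (`toKlein_eq_toKlein_iff`); the action is free and the group finite,
hence `toKlein` is a covering.

The plane is simply connected, so a class in either fundamental group is determined by the deck
transformation taking the origin to the endpoint of its lift (`liftEnd_injective`). Both
presentations follow from normal forms in these deck groups. The images of `x` and `y` come from
applying `e` to lifts, the values of `θ` from applying `e⁻¹`; exactness is covering theory.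

For the Borsuk-Ulam part, `h` is polar coordinates with a positive radius, so `h(z)` determines `b`
and `r(a)`. Even powers of `τ` fix `a`, so two points they relate coincide once their `b` agree. For
an odd power, `r(-a) = r(a)` forces `2a = 0`, and equality of the second coordinates then
contradicts parity (`coe_odd_div_ne_zero`), which also gives freeness. -/

section Presentations

/-! ### Two-generator presentations from normal forms. -/

variable {G : Type*} [Group G]

/-- If conjugation by `b` and by `b⁻¹` both send `a` to `a ^ δ`, then every element of the subgroup
generated by `a` and `b` has the form `a ^ m * b ^ n`. -/
lemma exists_lift_eq_zpow_mul_zpow {gens : Fin 2 → G} {δ : ℤ}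
    (h : SemiconjBy (gens 1) (gens 0) (gens 0 ^ δ))
    (h' : SemiconjBy (gens 1)⁻¹ (gens 0) (gens 0 ^ δ)) (w : FreeGroup (Fin 2)) :
    ∃ m n : ℤ, FreeGroup.lift gens w = gens 0 ^ m * gens 1 ^ n := by
  -- Left multiplication by any word preserves the set of normal forms; in this strengthened form
  -- the product case of the induction is mere composition.
  suffices H : ∀ m n : ℤ, ∃ m' n' : ℤ,
      FreeGroup.lift gens w * (gens 0 ^ m * gens 1 ^ n) = gens 0 ^ m' * gens 1 ^ n' by
    simpa using H 0 0
  induction w using FreeGroup.induction_on with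
  | C1 => exact fun m n => ⟨m, n, by simp⟩
  | of i =>
    intro m n
    fin_cases i
    · exact ⟨1 + m, n, by simp [zpow_add, mul_assoc]⟩
    · refine ⟨δ * m, 1 + n, ?_⟩
      have := (h.zpow_right m).eq
      simp only [Fin.mk_one, FreeGroup.lift_apply_of, zpow_add, zpow_one, zpow_mul]
      rw [← mul_assoc, this, mul_assoc]
  | inv_of i _ =>
    intro m n
    fin_cases i
    · exact ⟨-1 + m, n, by simp [zpow_add, mul_assoc]⟩
    · refine ⟨δ * m, -1 + n, ?_⟩
      have := (h'.zpow_right m).eq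
      simp only [Fin.mk_one, map_inv, FreeGroup.lift_apply_of, zpow_add, zpow_neg, zpow_one,
        zpow_mul]
      rw [← mul_assoc, this, mul_assoc]
  | mul x y hx hy =>
    intro m n
    obtain ⟨m₁, n₁, h₁⟩ := hy m n
    obtain ⟨m₂, n₂, h₂⟩ := hx m₁ n₁
    exact ⟨m₂, n₂, by rw [map_mul, mul_assoc, h₁, h₂]⟩

/-- A group in which `a ^ m * b ^ n` is a normal form is presented by `a`, `b` and any relator that
holds and that forces conjugation by `b` and by `b⁻¹` to send `a` to `a ^ δ`. -/
lemma isPresentedBy_of_normalForm {gens : Fin 2 → G} {r : FreeGroup (Fin 2)} (δ : ℤ)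
    (hr : FreeGroup.lift gens r = 1)
    (hrel : ∀ (H : Type) [Group H] (f : FreeGroup (Fin 2) →* H), f r = 1 →
      SemiconjBy (f (.of 1)) (f (.of 0)) (f (.of 0) ^ δ) ∧
        SemiconjBy (f (.of 1))⁻¹ (f (.of 0)) (f (.of 0) ^ δ))
    (hsurj : ∀ g : G, ∃ m n : ℤ, g = gens 0 ^ m * gens 1 ^ n)
    (hinj : ∀ m n : ℤ, gens 0 ^ m * gens 1 ^ n = 1 → m = 0 ∧ n = 0) :
    IsPresentedBy gens {r} := by
  have hle : Subgroup.normalClosure {r} ≤ (FreeGroup.lift gens).ker :=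
    Subgroup.normalClosure_le_normal (by simpa using hr)
  refine ⟨fun g => ?_, le_antisymm (fun w hw => ?_) hle⟩
  · obtain ⟨m, n, rfl⟩ := hsurj g
    exact ⟨.of 0 ^ m * .of 1 ^ n, by simp⟩
  · set N := Subgroup.normalClosure {r}
    -- The relator holds in `FreeGroup (Fin 2) ⧸ N`, so modulo `N` any `w` is some `a ^ m * b ^ n`.
    -- If `w` dies in `G`, uniqueness of normal forms there gives `m = n = 0`.
    obtain ⟨h₁, h₂⟩ := hrel _ (QuotientGroup.mk' N)
      ((QuotientGroup.eq_one_iff r).2 (Subgroup.subset_normalClosure rfl))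
    have hlift : FreeGroup.lift (fun i => QuotientGroup.mk' N (.of i)) = QuotientGroup.mk' N := by
      ext; simp
    obtain ⟨m, n, hmn⟩ := exists_lift_eq_zpow_mul_zpow
      (gens := fun i => QuotientGroup.mk' N (.of i)) h₁ h₂ w
    rw [hlift, ← map_zpow, ← map_zpow, ← map_mul] at hmn
    have hw' : w⁻¹ * (.of 0 ^ m * .of 1 ^ n) ∈ N := QuotientGroup.eq.1 hmn
    have h1 : gens 0 ^ m * gens 1 ^ n = 1 := by
      have := hle hw'
      rw [MonoidHom.mem_ker, map_mul, map_inv, MonoidHom.mem_ker.1 hw] at this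
      simpa using this
    obtain ⟨rfl, rfl⟩ := hinj m n h1
    simpa using hw'

lemma isPresentedBy_torusRelator {gens : Fin 2 → G} (h : Commute (gens 0) (gens 1))
    (hsurj : ∀ g : G, ∃ m n : ℤ, g = gens 0 ^ m * gens 1 ^ n)
    (hinj : ∀ m n : ℤ, gens 0 ^ m * gens 1 ^ n = 1 → m = 0 ∧ n = 0) :
    IsPresentedBy gens {torusRelator} := by
  refine isPresentedBy_of_normalForm 1 ?_ (fun H _ f hf => ?_) hsurj hinj
  · simp [torusRelator, h.eq]
  · have hc : Commute (f (.of 1)) (f (.of 0)) := by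
      simp only [torusRelator, map_mul, map_inv] at hf
      rw [mul_inv_eq_one, mul_inv_eq_iff_eq_mul] at hf
      exact hf.symm
    rw [zpow_one]
    exact ⟨hc, hc.inv_left⟩

lemma isPresentedBy_kleinRelator {gens : Fin 2 → G}
    (h : gens 0 * gens 1 * gens 0 = gens 1)
    (hsurj : ∀ g : G, ∃ m n : ℤ, g = gens 0 ^ m * gens 1 ^ n)
    (hinj : ∀ m n : ℤ, gens 0 ^ m * gens 1 ^ n = 1 → m = 0 ∧ n = 0) :
    IsPresentedBy gens {kleinRelator} := by
  refine isPresentedBy_of_normalForm (-1) ?_ (fun H _ f hf => ?_) hsurj hinj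
  · simp [kleinRelator, h]
  · simp only [kleinRelator, map_mul, map_inv] at hf
    rw [mul_inv_eq_one] at hf
    have h₁ : SemiconjBy (f (.of 1)) (f (.of 0)) (f (.of 0))⁻¹ := by
      rw [SemiconjBy, eq_inv_mul_iff_mul_eq, ← mul_assoc, hf]
    have h₂ := SemiconjBy.inv_symm_left h₁.inv_right
    rw [inv_inv] at h₂
    rw [zpow_neg_one]
    exact ⟨h₁, h₂⟩

end Presentations

/-! ### Deck transformations and path lifting. -/

section Coverings

variable {E X G : Type*} [TopologicalSpace E] [TopologicalSpace X] [Group G] [MulAction G E]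
  {p : E → X}

/-- Lifts are unique, so any explicit lift `Γ` computes the value. -/
lemma fundamentalGroupToMulOpposite_mk (hp : IsQuotientCoveringMap p G) {x : X} (e : p ⁻¹' {x})
    (γ : Path x x) (Γ : C(unitInterval, E)) (hΓ : ∀ t, p (Γ t) = γ t) (h₀ : Γ 0 = e) (g : G)
    (h₁ : Γ 1 = g • (e : E)) :
    hp.fundamentalGroupToMulOpposite e (FundamentalGroup.fromPath (.mk γ)) = .op g := by
  rw [IsQuotientCoveringMap.fundamentalGroupToMulOpposite_apply_eq_Iff]
  exact h₁.symm.trans congr($((hp.isCoveringMap.eq_liftPath_iff' (γ := (γ : C(unitInterval, X)))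
    (γ.source.trans e.2.symm)).2 ⟨funext hΓ, h₀⟩) 1)

lemma deckHom_mk {G : Type*} [CommGroup G] [MulAction G E] (hp : IsQuotientCoveringMap p G)
    {x : X} {e : E} (he : p e = x) (γ : Path x x) (Γ : C(unitInterval, E))
    (hΓ : ∀ t, p (Γ t) = γ t) (h₀ : Γ 0 = e) (g : G) (h₁ : Γ 1 = g • e) :
    deckHom hp ⟨e, he⟩ (FundamentalGroup.fromPath (.mk γ)) = g :=
  congrArg MulOpposite.unop (fundamentalGroupToMulOpposite_mk hp ⟨e, he⟩ γ Γ hΓ h₀ g h₁)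

lemma exists_homeomorph_of_isQuotientMap {s : Setoid E} {f : C(E, X)} (hf : Topology.IsQuotientMap f)
    (hs : ∀ a b, s a b ↔ f a = f b) :
    ∃ φ : Quotient s ≃ₜ X, ∀ a, φ (Quotient.mk s a) = f a := by
  obtain rfl : s = Setoid.ker f := by ext a b; exact hs a b
  exact ⟨hf.homeomorph, fun _ => rfl⟩

lemma mapOfEq_injective_of_isCoveringMap {p : C(E, X)} (hp : IsCoveringMap p) {e : E} {x : X}
    (h : p e = x) : Function.Injective (FundamentalGroup.mapOfEq p h) := by
  subst h
  intro γ γ' hγ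
  rw [FundamentalGroup.mapOfEq_apply, FundamentalGroup.mapOfEq_apply] at hγ
  have hγ' : Path.Homotopic.Quotient.map γ p = Path.Homotopic.Quotient.map γ' p := by
    simpa using hγ
  exact hp.injective_path_homotopic_map e e hγ'

/-- A class is in the kernel exactly when its lift from `e` closes up, that is, when it is the image
of a loop at `e`. -/
lemma ker_deckHom {G : Type*} [CommGroup G] [MulAction G E] {p : C(E, X)}
    (hp : IsQuotientCoveringMap p G) {e : E} {x : X} (h : p e = x) :
    (deckHom hp ⟨e, h⟩).ker = (FundamentalGroup.mapOfEq p h).range := by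
  refine Eq.trans ?_ ((hp.ker_fundamentalGroupToMulOpposite ⟨e, h⟩).trans
    (hp.ker_monodromyPerm ⟨e, h⟩))
  exact MonoidHom.ker_mulEquiv_comp _ (MulOpposite.opMulEquiv (M := G)).symm

lemma deckHom_surjective [PathConnectedSpace E] {G : Type*} [CommGroup G] [MulAction G E]
    (hp : IsQuotientCoveringMap p G) {x : X} (e : p ⁻¹' {x}) :
    Function.Surjective (deckHom hp e) :=
  (MulOpposite.opMulEquiv (M := G)).symm.surjective.comp
    (hp.fundamentalGroupToMulOpposite_surjective e)

end Coverings

/-! ### The plane over the torus, and the torus group. -/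

lemma UnitAddCircle.coe_eq_coe_iff (a b : ℝ) :
    (a : UnitAddCircle) = b ↔ ∃ n : ℤ, a = b + n := by
  rw [← sub_eq_zero, ← AddCircle.coe_sub, AddCircle.coe_eq_zero_iff]
  refine exists_congr fun n => ?_
  rw [zsmul_one, eq_sub_iff_add_eq, add_comm, eq_comm]

lemma eq_zero_of_abs_intCast_lt_one {n : ℤ} (h : |(n : ℝ)| < 1) : n = 0 := by
  rw [← Int.abs_lt_one_iff]
  exact_mod_cast h

namespace Torus

instance : MulAction (Multiplicative (ℤ × ℤ)) (ℝ × ℝ) where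
  smul g z := (z.1 + (g.toAdd.1 : ℝ), z.2 + (g.toAdd.2 : ℝ))
  one_smul z := by
    change (z.1 + ((0 : ℤ) : ℝ), z.2 + ((0 : ℤ) : ℝ)) = z
    simp
  mul_smul g h z := by
    change (z.1 + ((g.toAdd.1 + h.toAdd.1 : ℤ) : ℝ), z.2 + ((g.toAdd.2 + h.toAdd.2 : ℤ) : ℝ)) =
      (z.1 + (h.toAdd.1 : ℝ) + (g.toAdd.1 : ℝ), z.2 + (h.toAdd.2 : ℝ) + (g.toAdd.2 : ℝ))
    push_cast
    ext <;> dsimp only <;> ring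

lemma plane_smul_def (g : Multiplicative (ℤ × ℤ)) (z : ℝ × ℝ) :
    g • z = (z.1 + (g.toAdd.1 : ℝ), z.2 + (g.toAdd.2 : ℝ)) := rfl

lemma pt_eq_pt_iff (a b c d : ℝ) :
    pt a b = pt c d ↔ ∃ m n : ℤ, a = c + m ∧ b = d + n := by
  simp [pt, Prod.ext_iff, UnitAddCircle.coe_eq_coe_iff]

lemma isOpenQuotientMap_pt : IsOpenQuotientMap fun z : ℝ × ℝ => pt z.1 z.2 := by
  have h : IsOpenQuotientMap ((↑) : ℝ → UnitAddCircle) := QuotientAddGroup.isOpenQuotientMap_mk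
  exact h.prodMap h

lemma isQuotientCoveringMap_pt :
    IsQuotientCoveringMap (fun z : ℝ × ℝ => pt z.1 z.2) (Multiplicative (ℤ × ℤ)) where
  __ := isOpenQuotientMap_pt.isQuotientMap
  continuous_const_smul g := by simp only [plane_smul_def]; fun_prop
  apply_eq_iff_mem_orbit {z w} := by
    rw [pt_eq_pt_iff]
    constructor
    · rintro ⟨m, n, h₁, h₂⟩
      exact ⟨.ofAdd (m, n), Prod.ext h₁.symm h₂.symm⟩
    · rintro ⟨g, rfl⟩
      exact ⟨_, _, rfl, rfl⟩
  disjoint z := by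
    -- Two points of this ball are less than `1` apart, so an integer translation between them is
    -- trivial.
    refine ⟨Metric.ball z (1 / 2), Metric.ball_mem_nhds _ (by norm_num), fun g => ?_⟩
    rintro ⟨_, ⟨w, hw, rfl⟩, hw'⟩
    have h : dist (g • w) w < 1 := by
      have := dist_triangle_right (g • w) w z
      rw [Metric.mem_ball] at hw hw'
      linarith
    rw [plane_smul_def, Prod.dist_eq, max_lt_iff, Real.dist_eq, Real.dist_eq] at h
    simp only [add_sub_cancel_left] at h
    exact Prod.ext (eq_zero_of_abs_intCast_lt_one h.1) (eq_zero_of_abs_intCast_lt_one h.2)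

/-- The endpoint of the lift to the plane, which determines a class in the fundamental group. -/
noncomputable def liftEnd :
    FundamentalGroup Torus (pt 0 0) →* (Multiplicative (ℤ × ℤ))ᵐᵒᵖ :=
  isQuotientCoveringMap_pt.fundamentalGroupToMulOpposite ⟨(0, 0), rfl⟩

lemma liftEnd_injective : Function.Injective liftEnd :=
  isQuotientCoveringMap_pt.fundamentalGroupToMulOpposite_injective _

lemma liftEnd_x : liftEnd x = .op (.ofAdd (1, 0)) :=
  fundamentalGroupToMulOpposite_mk isQuotientCoveringMap_pt _ loopX
    ⟨fun t => ((t : ℝ), 0), by fun_prop⟩ (fun _ => rfl) (by simp) _ (by simp [plane_smul_def])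

lemma liftEnd_y : liftEnd y = .op (.ofAdd (0, 1)) :=
  fundamentalGroupToMulOpposite_mk isQuotientCoveringMap_pt _ loopY
    ⟨fun t => (0, (t : ℝ)), by fun_prop⟩ (fun _ => rfl) (by simp) _ (by simp [plane_smul_def])

lemma liftEnd_x_zpow_mul_y_zpow (m n : ℤ) : liftEnd (x ^ m * y ^ n) = .op (.ofAdd (m, n)) := by
  rw [map_mul, map_zpow, map_zpow, liftEnd_x, liftEnd_y, ← MulOpposite.op_zpow,
    ← MulOpposite.op_zpow, ← MulOpposite.op_mul, ← ofAdd_zsmul, ← ofAdd_zsmul, ← ofAdd_add]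
  simp

lemma isPresentedBy_x_y : IsPresentedBy ![x, y] {torusRelator} := by
  refine isPresentedBy_torusRelator ?_ (fun γ => ?_) (fun m n h => ?_)
  · apply liftEnd_injective
    change liftEnd (x * y) = liftEnd (y * x)
    rw [map_mul, map_mul, liftEnd_x, liftEnd_y]
    rfl
  · obtain ⟨g, hg⟩ := MulOpposite.op_surjective (liftEnd γ)
    exact ⟨g.toAdd.1, g.toAdd.2, liftEnd_injective
      (hg.symm.trans (liftEnd_x_zpow_mul_y_zpow _ _).symm)⟩
  · have h' := congrArg liftEnd h
    erw [liftEnd_x_zpow_mul_y_zpow, map_one] at h'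
    simpa using h'

end Torus

/-! ### The plane over the Klein bottle, and the Klein bottle group. -/

/-- The group of deck transformations `(a, b) ↦ ((-1)ⁿ a + m, b + n/2)` of the plane over the
Klein bottle. -/
@[ext]
structure KleinGroup where
  /-- The integer `m` of `(a, b) ↦ ((-1)ⁿ a + m, b + n/2)`. -/
  shift : ℤ
  /-- The integer `n` of `(a, b) ↦ ((-1)ⁿ a + m, b + n/2)`. -/
  turn : ℤ

namespace KleinGroup

/-- Composition of maps: the outer reflection acts on the inner shift. -/
instance : Mul KleinGroup := ⟨fun g h => ⟨g.shift + g.turn.negOnePow * h.shift, g.turn + h.turn⟩⟩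
instance : One KleinGroup := ⟨⟨0, 0⟩⟩
instance : Inv KleinGroup := ⟨fun g => ⟨-(g.turn.negOnePow * g.shift), -g.turn⟩⟩

lemma mk_mul_mk (m n m' n' : ℤ) :
    (⟨m, n⟩ * ⟨m', n'⟩ : KleinGroup) = ⟨m + n.negOnePow * m', n + n'⟩ := rfl

lemma one_def : (1 : KleinGroup) = ⟨0, 0⟩ := rfl

lemma inv_mk (m n : ℤ) : (⟨m, n⟩ : KleinGroup)⁻¹ = ⟨-(n.negOnePow * m), -n⟩ := rfl

instance : Group KleinGroup := .ofLeftAxioms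
  (fun ⟨_, _⟩ ⟨_, _⟩ ⟨_, _⟩ => by
    simp only [mk_mul_mk, Int.negOnePow_add, Units.val_mul]; ext <;> dsimp only <;> ring)
  (fun ⟨_, _⟩ => by simp [one_def, mk_mul_mk])
  (fun ⟨_, _⟩ => by simp [one_def, mk_mul_mk, inv_mk])

lemma mk_one_zero_zpow (m : ℤ) : (⟨1, 0⟩ : KleinGroup) ^ m = ⟨m, 0⟩ := by
  induction m with
  | zero => rfl
  | succ m ih => rw [zpow_add_one, ih, mk_mul_mk]; simp
  | pred m ih => rw [zpow_sub_one, ih, inv_mk, mk_mul_mk]; simp [sub_eq_add_neg]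

lemma mk_zero_one_zpow (n : ℤ) : (⟨0, 1⟩ : KleinGroup) ^ n = ⟨0, n⟩ := by
  induction n with
  | zero => rfl
  | succ n ih => rw [zpow_add_one, ih, mk_mul_mk]; simp
  | pred n ih => rw [zpow_sub_one, ih, inv_mk, mk_mul_mk]; simp [sub_eq_add_neg]

noncomputable instance : MulAction KleinGroup (ℝ × ℝ) where
  smul g z := (((g.turn.negOnePow : ℤ) : ℝ) * z.1 + g.shift, z.2 + g.turn / 2)
  one_smul z := by
    change (((Int.negOnePow 0 : ℤ) : ℝ) * z.1 + (0 : ℤ), z.2 + (0 : ℤ) / 2) = z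
    simp
  mul_smul := by
    rintro ⟨m, n⟩ ⟨m', n'⟩ z
    change ((((n + n').negOnePow : ℤ) : ℝ) * z.1 + (m + n.negOnePow * m' : ℤ),
        z.2 + (n + n' : ℤ) / 2) =
      (((n.negOnePow : ℤ) : ℝ) * (((n'.negOnePow : ℤ) : ℝ) * z.1 + m') + m, z.2 + n' / 2 + n / 2)
    rw [Int.negOnePow_add]
    push_cast
    ext <;> dsimp only <;> ring

lemma mk_smul (m n : ℤ) (z : ℝ × ℝ) :
    (⟨m, n⟩ : KleinGroup) • z = (((n.negOnePow : ℤ) : ℝ) * z.1 + m, z.2 + n / 2) := rfl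

end KleinGroup

namespace KleinBottle

/-- Even turns are the translations by `ℤ²`; odd turns are the involution followed by such
translations. -/
lemma pt_eq_pt_iff (a b c d : ℝ) :
    pt a b = pt c d ↔ ∃ g : KleinGroup, (a, b) = g • (c, d) := by
  have h : pt a b = pt c d ↔ Torus.pt a b = Torus.pt c d ∨
      Torus.pt a b = Torus.pt (-c) (d + 1 / 2) := Quotient.eq (r := Torus.kleinSetoid)
  simp only [h, Torus.pt_eq_pt_iff]
  constructor
  · rintro (⟨m, n, rfl, rfl⟩ | ⟨m, n, rfl, rfl⟩)
    · refine ⟨⟨m, 2 * n⟩, ?_⟩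
      simp [KleinGroup.mk_smul, Int.negOnePow_even (2 * n) (even_two_mul n)]
    · refine ⟨⟨m, 2 * n + 1⟩, ?_⟩
      simp [KleinGroup.mk_smul, Int.negOnePow_odd (2 * n + 1) (odd_two_mul_add_one n)]
      ring
  · rintro ⟨⟨m, n⟩, h⟩
    rw [KleinGroup.mk_smul, Prod.mk.injEq] at h
    obtain ⟨j, rfl | rfl⟩ := Int.even_or_odd' n
    · rw [Int.negOnePow_even (2 * j) (even_two_mul j)] at h
      refine Or.inl ⟨m, j, ?_, ?_⟩
      · simpa using h.1
      · rw [h.2]; push_cast; ring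
    · rw [Int.negOnePow_odd (2 * j + 1) (odd_two_mul_add_one j)] at h
      refine Or.inr ⟨m, j, ?_, ?_⟩
      · simpa using h.1
      · rw [h.2]; push_cast; ring

lemma isQuotientMap_pt : Topology.IsQuotientMap fun z : ℝ × ℝ => pt z.1 z.2 :=
  (isQuotientMap_quotient_mk' (s := Torus.kleinSetoid)).comp
    Torus.isOpenQuotientMap_pt.isQuotientMap

lemma isQuotientCoveringMap_pt :
    IsQuotientCoveringMap (fun z : ℝ × ℝ => pt z.1 z.2) KleinGroup where
  __ := isQuotientMap_pt
  continuous_const_smul := by rintro ⟨m, n⟩; simp only [KleinGroup.mk_smul]; fun_prop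
  apply_eq_iff_mem_orbit {z w} := by
    rw [pt_eq_pt_iff]
    exact exists_congr fun g => eq_comm
  disjoint z := by
    -- Second coordinates move by half-integers, hence the smaller radius. It forces `n = 0` first;
    -- then the sign is trivial and `m = 0` follows.
    refine ⟨Metric.ball z (1 / 4), Metric.ball_mem_nhds _ (by norm_num), ?_⟩
    rintro ⟨m, n⟩ ⟨_, ⟨w, hw, rfl⟩, hw'⟩
    have h : dist ((⟨m, n⟩ : KleinGroup) • w) w < 1 / 2 := by
      have := dist_triangle_right ((⟨m, n⟩ : KleinGroup) • w) w z
      rw [Metric.mem_ball] at hw hw'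
      linarith
    rw [KleinGroup.mk_smul, Prod.dist_eq, max_lt_iff, Real.dist_eq, Real.dist_eq] at h
    simp only [add_sub_cancel_left, abs_div, Nat.abs_ofNat] at h
    obtain rfl : n = 0 := eq_zero_of_abs_intCast_lt_one (by linarith)
    obtain rfl : m = 0 := eq_zero_of_abs_intCast_lt_one (by simpa using h.1.trans (by norm_num))
    rfl

/-- The endpoint of the lift to the plane, which determines a class in the fundamental group. -/
noncomputable def liftEnd : FundamentalGroup KleinBottle (pt 0 0) →* KleinGroupᵐᵒᵖ :=
  isQuotientCoveringMap_pt.fundamentalGroupToMulOpposite ⟨(0, 0), rfl⟩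

lemma liftEnd_injective : Function.Injective liftEnd :=
  isQuotientCoveringMap_pt.fundamentalGroupToMulOpposite_injective _

lemma liftEnd_mk {γ : Path (pt 0 0) (pt 0 0)} (f : C(unitInterval, ℝ × ℝ))
    (hf : ∀ t, pt (f t).1 (f t).2 = γ t) (h₀ : f 0 = (0, 0)) (m n : ℤ)
    (h₁ : f 1 = ((m : ℝ), (n : ℝ) / 2)) :
    liftEnd (FundamentalGroup.fromPath (.mk γ)) = .op ⟨m, n⟩ :=
  fundamentalGroupToMulOpposite_mk isQuotientCoveringMap_pt _ γ f hf h₀ _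
    (by simp [KleinGroup.mk_smul, h₁])

lemma liftEnd_u : liftEnd u = .op ⟨1, 0⟩ :=
  liftEnd_mk ⟨fun t => ((t : ℝ), 0), by fun_prop⟩ (fun _ => rfl) (by simp) _ _ (by simp)

lemma liftEnd_v : liftEnd v = .op ⟨0, 1⟩ :=
  liftEnd_mk ⟨fun t => (0, (t : ℝ) / 2), by fun_prop⟩ (fun _ => rfl) (by simp) _ _ (by simp)

/-- The values lie in the opposite group, so the product is `⟨0, n⟩ * ⟨m, 0⟩`; hence the sign. -/
lemma liftEnd_u_zpow_mul_v_zpow (m n : ℤ) :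
    liftEnd (u ^ m * v ^ n) = .op ⟨n.negOnePow * m, n⟩ := by
  rw [map_mul, map_zpow, map_zpow, liftEnd_u, liftEnd_v, ← MulOpposite.op_zpow,
    ← MulOpposite.op_zpow, ← MulOpposite.op_mul, KleinGroup.mk_one_zero_zpow,
    KleinGroup.mk_zero_one_zpow, KleinGroup.mk_mul_mk, zero_add, add_zero]

lemma isPresentedBy_u_v : IsPresentedBy ![u, v] {kleinRelator} := by
  refine isPresentedBy_kleinRelator ?_ (fun γ => ?_) (fun m n h => ?_)
  · apply liftEnd_injective
    change liftEnd (u * v * u) = liftEnd v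
    rw [map_mul, map_mul, liftEnd_u, liftEnd_v]
    rfl
  · obtain ⟨⟨m, n⟩, hg⟩ := MulOpposite.op_surjective (liftEnd γ)
    refine ⟨n.negOnePow * m, n, liftEnd_injective
      (hg.symm.trans ((liftEnd_u_zpow_mul_v_zpow _ _).trans ?_).symm)⟩
    rw [← mul_assoc, ← Units.val_mul, Int.units_mul_self, Units.val_one, one_mul]
  · have h' := congrArg liftEnd h
    erw [liftEnd_u_zpow_mul_v_zpow, map_one] at h'
    simpa [← MulOpposite.op_one, KleinGroup.one_def] using h'

end KleinBottle

/-! ### The free action of `ℤ/4k` generated by `τ`. -/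

namespace Torus

/-- The map `τ` as a permutation of the torus. -/
noncomputable def tauPerm (k : ℕ) : Equiv.Perm Torus where
  toFun := tau k
  invFun z := (-z.1, z.1 + z.2 - ((1 / (4 * (k : ℝ)) : ℝ) : UnitAddCircle))
  left_inv z := by ext <;> dsimp only [tau] <;> abel
  right_inv z := by ext <;> dsimp only [tau] <;> abel

/-- In `τ²` the contributions `a` and `-a` cancel, leaving translation of `b` by `1/(2k)`. -/
lemma tauPerm_zpow_even (k : ℕ) (j : ℤ) (z : Torus) :
    (tauPerm k ^ (2 * j)) z = (z.1, z.2 + ((j / (2 * k) : ℝ) : UnitAddCircle)) := by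
  have h₂ (z : Torus) : (tauPerm k ^ (2 : ℤ)) z =
      (z.1, z.2 + ((1 / (2 * k) : ℝ) : UnitAddCircle)) := by
    have h : (1 / (2 * k) : ℝ) = 1 / (4 * k) + 1 / (4 * k) := by field_simp; norm_num
    rw [h, AddCircle.coe_add, zpow_ofNat, pow_two]
    simp only [Equiv.Perm.mul_apply, tauPerm, Equiv.coe_fn_mk, tau]
    ext <;> dsimp only <;> abel
  rw [zpow_mul]
  induction j generalizing z with
  | zero => simp
  | succ j ih =>
    rw [zpow_add_one, Equiv.Perm.mul_apply, h₂, ih, add_assoc, ← AddCircle.coe_add]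
    push_cast
    rw [← add_div, add_comm (1 : ℝ)]
  | pred j ih =>
    have h := h₂ (z.1, z.2 - ((1 / (2 * k) : ℝ) : UnitAddCircle))
    rw [sub_add_cancel] at h
    rw [zpow_sub_one, Equiv.Perm.mul_apply, Equiv.Perm.inv_eq_iff_eq.2 h.symm, ih, sub_eq_add_neg,
      add_assoc, ← AddCircle.coe_neg, ← AddCircle.coe_add]
    push_cast
    rw [← neg_div, ← add_div, neg_add_eq_sub, sub_eq_add_neg (-(j : ℝ))]

lemma tauPerm_zpow_odd (k : ℕ) (j : ℤ) (z : Torus) :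
    (tauPerm k ^ (2 * j + 1)) z =
      (-z.1, z.1 + z.2 + (((2 * j + 1) / (4 * k) : ℝ) : UnitAddCircle)) := by
  have h : ((2 * j + 1) / (4 * k) : ℝ) = 1 / (4 * k) + j / (2 * k) := by field_simp; ring
  rw [zpow_add_one, Equiv.Perm.mul_apply, tauPerm_zpow_even, h, AddCircle.coe_add, ← add_assoc]
  rfl

lemma tauPerm_zpow_even_pt (k : ℕ) (j : ℤ) (a b : ℝ) :
    (tauPerm k ^ (2 * j)) (pt a b) = pt a (b + j / (2 * k)) := by
  rw [tauPerm_zpow_even, pt, pt, AddCircle.coe_add]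

lemma tauPerm_zpow_odd_pt (k : ℕ) (j : ℤ) (a b : ℝ) :
    (tauPerm k ^ (2 * j + 1)) (pt a b) = pt (-a) (a + b + (2 * j + 1) / (4 * k)) := by
  rw [tauPerm_zpow_odd, pt, pt, AddCircle.coe_add, AddCircle.coe_add, AddCircle.coe_neg]

lemma tauPerm_zpow_order (k : ℕ) : tauPerm k ^ ((4 * k : ℕ) : ℤ) = 1 := by
  obtain rfl | hk := k.eq_zero_or_pos
  · rfl
  · ext1 z
    have h : ((4 * k : ℕ) : ℤ) = 2 * (2 * k : ℤ) := by push_cast; ring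
    have h' : (((2 * k : ℤ) : ℝ) / (2 * k) : ℝ) = 1 := by push_cast; field_simp
    rw [h, tauPerm_zpow_even, h', coe_one, add_zero]
    rfl

/-- The homomorphism from `ℤ/4k` to the permutations of the torus sending `1` to `τ`. -/
noncomputable def tauHom (k : ℕ) : Multiplicative (ZMod (4 * k)) →* Equiv.Perm Torus :=
  AddMonoidHom.toMultiplicativeLeft (ZMod.lift (4 * k)
    ⟨zmultiplesHom _ (Additive.ofMul (tauPerm k)),
      congrArg Additive.ofMul (tauPerm_zpow_order k)⟩)

noncomputable instance tauAction (k : ℕ) : MulAction (Multiplicative (ZMod (4 * k))) Torus :=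
  MulAction.compHom Torus (tauHom k)

lemma ofAdd_intCast_smul (k : ℕ) (i : ℤ) (z : Torus) :
    Multiplicative.ofAdd (i : ZMod (4 * k)) • z = (tauPerm k ^ i) z := by
  have h : tauHom k (.ofAdd (i : ZMod (4 * k))) = tauPerm k ^ i := by
    simp [tauHom]
  exact congrArg (fun σ : Equiv.Perm Torus => σ z) h

lemma ofAdd_one_smul (k : ℕ) (z : Torus) :
    Multiplicative.ofAdd (1 : ZMod (4 * k)) • z = tau k z := by
  have := ofAdd_intCast_smul k 1 z
  rwa [Int.cast_one, zpow_one] at this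

/-- Every element of `ℤ/4k` acts as `(a, b) ↦ (a, b + j/2k)` or as
`(a, b) ↦ (-a, a + b + (2j+1)/4k)`. -/
lemma smul_cases {k : ℕ} (g : Multiplicative (ZMod (4 * k))) :
    ∃ j : ℤ,
      (g = .ofAdd ((2 * j : ℤ) : ZMod (4 * k)) ∧ ∀ z : Torus,
        g • z = (z.1, z.2 + ((j / (2 * k) : ℝ) : UnitAddCircle))) ∨
      (∀ z : Torus,
        g • z = (-z.1, z.1 + z.2 + (((2 * j + 1) / (4 * k) : ℝ) : UnitAddCircle))) := by
  obtain ⟨i, hi⟩ := ZMod.intCast_surjective g.toAdd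
  obtain rfl : Multiplicative.ofAdd (i : ZMod (4 * k)) = g := congrArg Multiplicative.ofAdd hi
  obtain ⟨j, rfl | rfl⟩ := Int.even_or_odd' i
  · exact ⟨j, Or.inl ⟨rfl, fun z => by rw [ofAdd_intCast_smul, tauPerm_zpow_even]⟩⟩
  · exact ⟨j, Or.inr fun z => by rw [ofAdd_intCast_smul, tauPerm_zpow_odd]⟩

instance (k : ℕ) : ContinuousConstSMul (Multiplicative (ZMod (4 * k))) Torus where
  continuous_const_smul g := by
    obtain ⟨j, ⟨-, h⟩ | h⟩ := smul_cases g <;> simp only [h] <;> fun_prop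

/-- Since `2a = 0`, doubling would make `(2j + 1)/(2k)` an integer, so an odd number would be even.
-/
lemma coe_odd_div_ne_zero {k : ℕ} (hk : 0 < k) (j : ℤ) {a : UnitAddCircle} (ha : -a = a) :
    a + (((2 * j + 1) / (4 * k) : ℝ) : UnitAddCircle) ≠ 0 := by
  intro h
  have h₂ : (((2 * j + 1) / (2 * k) : ℝ) : UnitAddCircle) = 0 := by
    have : ((2 * j + 1) / (2 * k) : ℝ) = (2 * j + 1) / (4 * k) + (2 * j + 1) / (4 * k) := by
      field_simp; ring
    rw [this, AddCircle.coe_add, ← neg_eq_of_add_eq_zero_right h]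
    nth_rewrite 1 [ha]
    exact add_neg_cancel a
  obtain ⟨n, hn⟩ := (AddCircle.coe_eq_zero_iff 1).1 h₂
  rw [zsmul_one, eq_div_iff (by positivity)] at hn
  have : n * (2 * k) = 2 * j + 1 := by exact_mod_cast hn
  have h3 : 2 * (n * k) = 2 * j + 1 := by rw [← this]; ring
  omega

lemma isFreeAction {k : ℕ} (hk : 0 < k) :
    IsFreeAction (Multiplicative (ZMod (4 * k))) Torus := by
  intro g z hz
  obtain ⟨j, ⟨rfl, h⟩ | h⟩ := smul_cases g
  · rw [h] at hz
    have h0 : ((j / (2 * k) : ℝ) : UnitAddCircle) = 0 := by simpa using congrArg Prod.snd hz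
    obtain ⟨n, hn⟩ := (AddCircle.coe_eq_zero_iff 1).1 h0
    rw [zsmul_one, eq_div_iff (by positivity)] at hn
    have hj : n * (2 * k) = j := by exact_mod_cast hn
    have : ((2 * j : ℤ) : ZMod (4 * k)) = 0 := by
      rw [ZMod.intCast_zmod_eq_zero_iff_dvd]
      exact ⟨n, by rw [← hj]; push_cast; ring⟩
    rw [this]
    rfl
  · rw [h] at hz
    refine absurd ?_ (coe_odd_div_ne_zero hk j (congrArg Prod.fst hz))
    have := congrArg Prod.snd hz
    dsimp only at this
    rwa [add_right_comm, add_eq_right] at this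

lemma isCancelSMul {k : ℕ} (hk : 0 < k) : IsCancelSMul (Multiplicative (ZMod (4 * k))) Torus :=
  isCancelSMul_iff_eq_one_of_smul_eq.2 (isFreeAction hk)

/-! ### The covering of the Klein bottle by the torus. -/

/-- The map `(a, b) ↦ g(a, ka + 2kb)` from the torus to the Klein bottle. -/
def toKlein (k : ℕ) : C(Torus, KleinBottle) where
  toFun z := Quotient.mk kleinSetoid (z.1, k • z.1 + (2 * k) • z.2)
  continuous_toFun := continuous_quotient_mk'.comp (by fun_prop)

lemma toKlein_pt (k : ℕ) (a b : ℝ) : toKlein k (pt a b) = KleinBottle.pt a (k * a + 2 * k * b) := by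
  simp only [toKlein, pt, KleinBottle.pt, ContinuousMap.coe_mk, AddCircle.coe_add]
  congr 3
  · rw [← AddCircle.coe_nsmul, nsmul_eq_mul]
  · rw [← AddCircle.coe_nsmul, nsmul_eq_mul]; push_cast; rfl

lemma isQuotientMap_toKlein {k : ℕ} (hk : 0 < k) : Topology.IsQuotientMap (toKlein k) := by
  let e : ℝ × ℝ ≃ₜ ℝ × ℝ :=
    { toFun := fun z => (z.1, k * z.1 + 2 * k * z.2)
      invFun := fun z => (z.1, (z.2 - k * z.1) / (2 * k))
      left_inv := fun z => by ext <;> simp; field_simp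
      right_inv := fun z => by ext <;> simp; field_simp; ring
      continuous_toFun := by fun_prop
      continuous_invFun := by fun_prop }
  refine .of_comp isOpenQuotientMap_pt.continuous (toKlein k).continuous ?_
  convert KleinBottle.isQuotientMap_pt.comp e.isQuotientMap using 1
  ext z
  exact toKlein_pt k z.1 z.2

lemma toKlein_eq_toKlein_iff {k : ℕ} (hk : 0 < k) (z w : Torus) :
    toKlein k z = toKlein k w ↔ z ∈ MulAction.orbit (Multiplicative (ZMod (4 * k))) w := by
  obtain ⟨⟨a, b⟩, rfl⟩ := isOpenQuotientMap_pt.surjective z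
  obtain ⟨⟨c, d⟩, rfl⟩ := isOpenQuotientMap_pt.surjective w
  have hk' : (k : ℝ) ≠ 0 := by positivity
  constructor
  · rw [toKlein_pt, toKlein_pt, KleinBottle.pt_eq_pt_iff]
    rintro ⟨⟨m, n⟩, h⟩
    rw [KleinGroup.mk_smul, Prod.mk.injEq] at h
    dsimp only at h
    obtain ⟨h₁, h₂⟩ := h
    obtain ⟨j, rfl | rfl⟩ := Int.even_or_odd' n
    · rw [Int.negOnePow_even (2 * j) (even_two_mul j)] at h₁
      push_cast at h₁ h₂
      -- From `a = c + m` and `ka + 2kb = kc + 2kd + j` one gets `b = d + (j - km)/(2k)`. The odd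
      -- case is solved likewise.
      refine ⟨.ofAdd ((2 * (j - k * m) : ℤ) : ZMod (4 * k)), ?_⟩
      dsimp only
      rw [ofAdd_intCast_smul, tauPerm_zpow_even_pt, pt_eq_pt_iff]
      refine ⟨-m, 0, by push_cast; linarith, ?_⟩
      push_cast
      field_simp
      subst h₁
      linarith
    · rw [Int.negOnePow_odd (2 * j + 1) (odd_two_mul_add_one j)] at h₁
      push_cast at h₁ h₂
      refine ⟨.ofAdd ((2 * (j - k * m) + 1 : ℤ) : ZMod (4 * k)), ?_⟩
      dsimp only
      rw [ofAdd_intCast_smul, tauPerm_zpow_odd_pt, pt_eq_pt_iff]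
      refine ⟨-m, 0, by push_cast; linarith, ?_⟩
      push_cast
      field_simp
      subst h₁
      linarith
  · rintro ⟨g, hg⟩
    obtain ⟨i, hi⟩ := ZMod.intCast_surjective g.toAdd
    obtain rfl : Multiplicative.ofAdd (i : ZMod (4 * k)) = g := congrArg Multiplicative.ofAdd hi
    dsimp only at hg
    change toKlein k (pt a b) = toKlein k (pt c d)
    rw [← hg, ofAdd_intCast_smul]
    -- Conjugation by `e` turns the lift of `τ ^ i` into the deck transformation with shift `0` and
    -- turn `i`.
    obtain ⟨j, rfl | rfl⟩ := Int.even_or_odd' i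
    · rw [tauPerm_zpow_even_pt, toKlein_pt, toKlein_pt, KleinBottle.pt_eq_pt_iff]
      refine ⟨⟨0, 2 * j⟩, ?_⟩
      rw [KleinGroup.mk_smul, Int.negOnePow_even (2 * j) (even_two_mul j)]
      ext <;> push_cast <;> field_simp <;> ring
    · rw [tauPerm_zpow_odd_pt, toKlein_pt, toKlein_pt, KleinBottle.pt_eq_pt_iff]
      refine ⟨⟨0, 2 * j + 1⟩, ?_⟩
      rw [KleinGroup.mk_smul, Int.negOnePow_odd (2 * j + 1) (odd_two_mul_add_one j)]
      ext <;> push_cast <;> field_simp <;> ring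

lemma isQuotientCoveringMap_toKlein {k : ℕ} (hk : 0 < k) :
    IsQuotientCoveringMap (toKlein k) (Multiplicative (ZMod (4 * k))) := by
  have := isCancelSMul hk
  have : NeZero (4 * k) := ⟨by positivity⟩
  have : Finite (Multiplicative (ZMod (4 * k))) := inferInstanceAs (Finite (ZMod (4 * k)))
  exact (isQuotientMap_toKlein hk).isQuotientCoveringMap_of_properlyDiscontinuousSMul
    fun {z w} => toKlein_eq_toKlein_iff hk z w

lemma toKlein_pt_zero (k : ℕ) : toKlein k (pt 0 0) = KleinBottle.pt 0 0 := by
  simpa using toKlein_pt k 0 0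

lemma exists_homeomorph_orbitSpace {k : ℕ} (hk : 0 < k) :
    ∃ φ : OrbitSpace (Multiplicative (ZMod (4 * k))) Torus ≃ₜ KleinBottle,
      ∀ z, toKlein k z = φ (orbitProj (Multiplicative (ZMod (4 * k))) Torus z) := by
  obtain ⟨φ, hφ⟩ := exists_homeomorph_of_isQuotientMap
    (s := MulAction.orbitRel (Multiplicative (ZMod (4 * k))) Torus) (isQuotientMap_toKlein hk)
    fun z w => (toKlein_eq_toKlein_iff hk z w).symm
  exact ⟨φ, fun z => (hφ z).symm⟩

/-- If `f` lifts `γ` to the plane, then `e ∘ f` lifts its image in the Klein bottle. -/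
lemma liftEnd_mapOfEq_mk (k : ℕ) (γ : Path (pt 0 0) (pt 0 0)) (f : C(unitInterval, ℝ × ℝ))
    (hf : ∀ t, pt (f t).1 (f t).2 = γ t) (h₀ : f 0 = (0, 0)) (m n : ℤ)
    (h₁ : (f 1).1 = m ∧ k * (f 1).1 + 2 * k * (f 1).2 = (n : ℝ) / 2) :
    KleinBottle.liftEnd (FundamentalGroup.mapOfEq (toKlein k) (toKlein_pt_zero k)
      (FundamentalGroup.fromPath (.mk γ))) = .op ⟨m, n⟩ := by
  rw [FundamentalGroup.mapOfEq_apply]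
  refine KleinBottle.liftEnd_mk
    (γ := (γ.map (toKlein k).continuous).cast (toKlein_pt_zero k).symm (toKlein_pt_zero k).symm)
    ⟨fun t => ((f t).1, k * (f t).1 + 2 * k * (f t).2), by fun_prop⟩ (fun t => ?_) ?_ m n ?_
  · exact (toKlein_pt k _ _).symm.trans (congrArg (toKlein k) (hf t))
  · simp [h₀]
  · exact Prod.ext h₁.1 h₁.2

lemma mapOfEq_toKlein_x (k : ℕ) :
    FundamentalGroup.mapOfEq (toKlein k) (toKlein_pt_zero k) x =
      KleinBottle.u * KleinBottle.v ^ (2 * k) := by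
  apply KleinBottle.liftEnd_injective
  have h := KleinBottle.liftEnd_u_zpow_mul_v_zpow 1 ((2 * k : ℕ) : ℤ)
  rw [zpow_one, zpow_natCast] at h
  rw [h, Int.negOnePow_even _ (by simp)]
  exact liftEnd_mapOfEq_mk k loopX ⟨fun t => ((t : ℝ), 0), by fun_prop⟩ (fun _ => rfl) (by simp)
    _ _ (by simp)

lemma mapOfEq_toKlein_y (k : ℕ) :
    FundamentalGroup.mapOfEq (toKlein k) (toKlein_pt_zero k) y = KleinBottle.v ^ (4 * k) := by
  apply KleinBottle.liftEnd_injective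
  have h := KleinBottle.liftEnd_u_zpow_mul_v_zpow 0 ((4 * k : ℕ) : ℤ)
  rw [zpow_zero, zpow_natCast, one_mul] at h
  rw [h, mul_zero]
  exact liftEnd_mapOfEq_mk k loopY ⟨fun t => (0, (t : ℝ)), by fun_prop⟩ (fun _ => rfl) (by simp)
    _ _ ⟨by simp, by simp; ring⟩

lemma deckHom_toKlein_u {k : ℕ} (hk : 0 < k) :
    deckHom (isQuotientCoveringMap_toKlein hk) ⟨pt 0 0, toKlein_pt_zero k⟩ KleinBottle.u =
      .ofAdd ((2 * k : ℕ) : ZMod (4 * k)) := by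
  have hk' : (k : ℝ) ≠ 0 := by positivity
  refine deckHom_mk _ _ KleinBottle.loopU
    -- This is `e⁻¹(t, 0)` up to the factor `k`, which cancels: `(0 - kt)/(2k) = -t/2`.
    ⟨fun t => pt t (-(t : ℝ) / 2), continuous_pt (by fun_prop) (by fun_prop)⟩
    (fun t => ?_) (by simp) _ ?_
  · refine (toKlein_pt k _ _).trans (congrArg (KleinBottle.pt t) ?_)
    ring
  · have h := ofAdd_intCast_smul k (2 * k : ℤ) (pt 0 0)
    rw [tauPerm_zpow_even_pt] at h
    push_cast at h ⊢
    rw [h]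
    -- The lift ends at `(1, -1/2)`, which is `(0, 1/2)` modulo `ℤ²`.
    refine (pt_eq_pt_iff _ _ _ _).2 ⟨1, -1, by simp, ?_⟩
    push_cast
    simp
    field_simp
    norm_num

lemma deckHom_toKlein_v {k : ℕ} (hk : 0 < k) :
    deckHom (isQuotientCoveringMap_toKlein hk) ⟨pt 0 0, toKlein_pt_zero k⟩ KleinBottle.v =
      .ofAdd (1 : ZMod (4 * k)) := by
  have hk' : (k : ℝ) ≠ 0 := by positivity
  refine deckHom_mk _ _ KleinBottle.loopV
    -- This is `e⁻¹(0, t/2)`.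
    ⟨fun t => pt 0 (t / (4 * k)), continuous_pt (by fun_prop) (by fun_prop)⟩
    (fun t => ?_) (by simp) _ ?_
  · refine (toKlein_pt k _ _).trans (congrArg (KleinBottle.pt 0) ?_)
    field_simp
    ring
  · rw [ofAdd_one_smul]
    simp [tau, pt]

/-! ### Failure of the Borsuk-Ulam property. -/

/-- The radius function `r` on the circle: `r(a) = 1 + 2 |a - 1/4|`. -/
noncomputable def circleRadius (a : UnitAddCircle) : ℝ :=
  1 + 2 * ‖a - ((1 / 4 : ℝ) : UnitAddCircle)‖

lemma circleRadius_pos (a : UnitAddCircle) : 0 < circleRadius a := by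
  unfold circleRadius; positivity

lemma circleRadius_coe {a : ℝ} (ha : a ∈ Set.Icc (0 : ℝ) 1) : circleRadius a = radius a := by
  have hn (x : ℝ) (hx : |x| ≤ 1 / 2) : ‖(x : UnitAddCircle)‖ = |x| :=
    (AddCircle.norm_coe_eq_abs_iff 1 one_ne_zero).2 (by simpa using hx)
  obtain ⟨h₀, h₁⟩ := ha
  rw [circleRadius, radius, ← AddCircle.coe_sub]
  split_ifs with h h'
  · rw [hn _ (abs_le.2 ⟨by linarith, by linarith⟩), abs_of_nonpos (by linarith)]
    ring
  · rw [hn _ (abs_le.2 ⟨by linarith, by linarith⟩), abs_of_nonneg (by linarith)]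
    ring
  -- Beyond `a = 3/4` the representative of `a - 1/4` nearest to `0` is `a - 5/4`.
  · have : ((a - 1 / 4 : ℝ) : UnitAddCircle) = ((a - 5 / 4 : ℝ) : UnitAddCircle) :=
      (UnitAddCircle.coe_eq_coe_iff _ _).2 ⟨1, by push_cast; ring⟩
    rw [this, hn _ (abs_le.2 ⟨by linarith, by linarith⟩), abs_of_nonpos (by linarith)]
    ring

lemma _root_.UnitAddCircle.eq_or_eq_neg_of_norm_eq {a b : UnitAddCircle} (h : ‖a‖ = ‖b‖) :
    a = b ∨ a = -b := by
  obtain ⟨a, rfl⟩ := QuotientAddGroup.mk_surjective a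
  obtain ⟨b, rfl⟩ := QuotientAddGroup.mk_surjective b
  change ‖((a : ℝ) : UnitAddCircle)‖ = ‖((b : ℝ) : UnitAddCircle)‖ at h
  rw [UnitAddCircle.norm_eq, UnitAddCircle.norm_eq] at h
  obtain h | h := abs_eq_abs.1 h
  · refine Or.inl ((UnitAddCircle.coe_eq_coe_iff a b).2 ⟨round a - round b, ?_⟩)
    push_cast
    linarith
  · refine Or.inr ((UnitAddCircle.coe_eq_coe_iff a (-b)).2 ⟨round a + round b, ?_⟩)
    push_cast
    linarith

/-- The only points of equal radius are `a` and `1/2 - a`, and `-a = 1/2 - a` is impossible on the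
circle. This is why `r` is centred at `1/4`. -/
lemma neg_eq_self_of_circleRadius_eq {a : UnitAddCircle} (h : circleRadius (-a) = circleRadius a) :
    -a = a := by
  simp only [circleRadius, add_right_inj, mul_eq_mul_left_iff, OfNat.ofNat_ne_zero, or_false] at h
  obtain h | h := UnitAddCircle.eq_or_eq_neg_of_norm_eq h
  · exact sub_left_injective h
  · have h' : ((1 / 4 : ℝ) : UnitAddCircle) = ((-(1 / 4) : ℝ) : UnitAddCircle) := by
      rw [neg_sub, sub_eq_add_neg, sub_eq_add_neg, add_comm, add_left_inj] at h
      rw [AddCircle.coe_neg, h]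
    obtain ⟨n, hn⟩ := (UnitAddCircle.coe_eq_coe_iff _ _).1 h'
    have h2 : (2 : ℝ) * n = 1 := by linarith
    have h3 : 2 * n = 1 := by exact_mod_cast h2
    omega

/-- The map `(a, b) ↦ (r(a) cos 2πb, r(a) sin 2πb)` from the torus to the plane. -/
noncomputable def toPlane : C(Torus, EuclideanSpace ℝ (Fin 2)) where
  toFun z := !₂[circleRadius z.1 * (AddCircle.toCircle z.2 : ℂ).re,
    circleRadius z.1 * (AddCircle.toCircle z.2 : ℂ).im]
  continuous_toFun := by
    have h₁ : Continuous fun z : Torus => circleRadius z.1 := by unfold circleRadius; fun_prop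
    have h₂ : Continuous fun z : Torus => (AddCircle.toCircle z.2 : ℂ) :=
      continuous_subtype_val.comp (AddCircle.continuous_toCircle.comp continuous_snd)
    refine (PiLp.continuous_toLp 2 _).comp (continuous_pi fun i => ?_)
    fin_cases i
    · exact h₁.mul (Complex.continuous_re.comp h₂)
    · exact h₁.mul (Complex.continuous_im.comp h₂)

lemma toPlane_pt {a : ℝ} (ha : a ∈ Set.Icc (0 : ℝ) 1) (b : ℝ) :
    toPlane (pt a b) =
      !₂[radius a * Real.cos (2 * Real.pi * b), radius a * Real.sin (2 * Real.pi * b)] := by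
  simp only [toPlane, pt, ContinuousMap.coe_mk, circleRadius_coe ha, AddCircle.toCircle_apply_mk,
    Circle.coe_exp, div_one, Complex.exp_ofReal_mul_I_re, Complex.exp_ofReal_mul_I_im]

/-- Polar coordinates: the modulus gives the radius, and positivity allows dividing it out to
recover the angle. -/
lemma toPlane_eq_toPlane {z w : Torus} (h : toPlane z = toPlane w) :
    circleRadius z.1 = circleRadius w.1 ∧ z.2 = w.2 := by
  have h' : (circleRadius z.1 : ℂ) * AddCircle.toCircle z.2 =
      circleRadius w.1 * AddCircle.toCircle w.2 := by
    apply Complex.ext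
    · simpa [toPlane] using congrArg (fun v : EuclideanSpace ℝ (Fin 2) => v 0) h
    · simpa [toPlane] using congrArg (fun v : EuclideanSpace ℝ (Fin 2) => v 1) h
  have hr : circleRadius z.1 = circleRadius w.1 := by
    simpa [abs_of_pos (circleRadius_pos _), Circle.norm_coe] using congrArg norm h'
  refine ⟨hr, AddCircle.injective_toCircle one_ne_zero (Circle.ext ?_)⟩
  rw [hr] at h'
  exact mul_left_cancel₀ (Complex.ofReal_ne_zero.2 (circleRadius_pos _).ne') h'

lemma smul_eq_self_of_toPlane_eq {k : ℕ} (hk : 0 < k) {g : Multiplicative (ZMod (4 * k))}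
    {z : Torus} (h : toPlane (g • z) = toPlane z) : g • z = z := by
  obtain ⟨h₁, h₂⟩ := toPlane_eq_toPlane h
  obtain ⟨j, ⟨-, hj⟩ | hj⟩ := smul_cases g
  · exact Prod.ext (by rw [hj]) h₂
  · rw [hj] at h₁ h₂
    refine absurd ?_ (coe_odd_div_ne_zero hk j (neg_eq_self_of_circleRadius_eq h₁))
    dsimp only at h₂
    rwa [add_right_comm, add_eq_right] at h₂

lemma injOn_toPlane_orbit {k : ℕ} (hk : 0 < k) (z : Torus) :
    Set.InjOn toPlane (MulAction.orbit (Multiplicative (ZMod (4 * k))) z) := by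
  intro w hw w' hw' h
  rw [← MulAction.orbit_eq_iff.2 hw'] at hw
  obtain ⟨g, rfl⟩ := hw
  exact smul_eq_self_of_toPlane_eq hk h

lemma not_hasBorsukUlam {k : ℕ} (hk : 0 < k) :
    ¬ HasBorsukUlam (Multiplicative (ZMod (4 * k))) Torus (EuclideanSpace ℝ (Fin 2)) := by
  intro h
  obtain ⟨g₁, g₂, hne, z, hz⟩ := h (Quotient.mk _ toPlane) toPlane rfl
  have := isCancelSMul hk
  exact hne (IsCancelSMul.right_cancel _ _ z (injOn_toPlane_orbit hk z ⟨g₁, rfl⟩ ⟨g₂, rfl⟩ hz))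

end Torus

theorem lemma4p5 (k : ℕ) (hk : 0 < k) :
    ∃ _ : MulAction (Multiplicative (ZMod (4 * k))) Torus,
      -- the generator acts by `τ`, and the action is continuous and free
      (∀ z : Torus, Multiplicative.ofAdd (1 : ZMod (4 * k)) • z = Torus.tau k z) ∧
      ContinuousConstSMul (Multiplicative (ZMod (4 * k))) Torus ∧
      IsFreeAction (Multiplicative (ZMod (4 * k))) Torus ∧
      -- the orbit space is the Klein bottle; `p` is the orbit projection followed by
      -- a homeomorphism, and it is a covering with group `ℤ/4k`
      (∃ (φ : OrbitSpace (Multiplicative (ZMod (4 * k))) Torus ≃ₜ KleinBottle)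
          (p : C(Torus, KleinBottle))
          (hp : IsQuotientCoveringMap p (Multiplicative (ZMod (4 * k))))
          (hb : p (Torus.pt 0 0) = KleinBottle.pt 0 0),
        (∀ z, p z = φ (orbitProj (Multiplicative (ZMod (4 * k))) Torus z)) ∧
        IsPresentedBy ![Torus.x, Torus.y] {torusRelator} ∧
        IsPresentedBy ![KleinBottle.u, KleinBottle.v] {kleinRelator} ∧
        -- the sequence is short exact
        Function.Injective (FundamentalGroup.mapOfEq p hb) ∧
        (FundamentalGroup.mapOfEq p hb).range = (deckHom hp ⟨Torus.pt 0 0, hb⟩).ker ∧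
        Function.Surjective (deckHom hp ⟨Torus.pt 0 0, hb⟩) ∧
        -- the induced homomorphisms on generators
        FundamentalGroup.mapOfEq p hb Torus.x = KleinBottle.u * KleinBottle.v ^ (2 * k) ∧
        FundamentalGroup.mapOfEq p hb Torus.y = KleinBottle.v ^ (4 * k) ∧
        deckHom hp ⟨Torus.pt 0 0, hb⟩ KleinBottle.u =
          Multiplicative.ofAdd ((2 * k : ℕ) : ZMod (4 * k)) ∧
        deckHom hp ⟨Torus.pt 0 0, hb⟩ KleinBottle.v =
          Multiplicative.ofAdd (1 : ZMod (4 * k))) ∧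
      -- the Borsuk-Ulam property fails, as shown by an explicit map
      ¬ HasBorsukUlam (Multiplicative (ZMod (4 * k))) Torus (EuclideanSpace ℝ (Fin 2)) ∧
      ∃ h : C(Torus, EuclideanSpace ℝ (Fin 2)),
        (∀ a ∈ Set.Icc (0 : ℝ) 1, ∀ b ∈ Set.Icc (0 : ℝ) 1, h (Torus.pt a b) =
          !₂[radius a * Real.cos (2 * Real.pi * b), radius a * Real.sin (2 * Real.pi * b)]) ∧
        ∀ z : Torus, Set.InjOn h (MulAction.orbit (Multiplicative (ZMod (4 * k))) z) := by
  obtain ⟨φ, hφ⟩ := Torus.exists_homeomorph_orbitSpace hk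
  have hcov := Torus.isQuotientCoveringMap_toKlein hk
  exact ⟨Torus.tauAction k, Torus.ofAdd_one_smul k, inferInstance, Torus.isFreeAction hk,
    ⟨φ, Torus.toKlein k, hcov, Torus.toKlein_pt_zero k, hφ, Torus.isPresentedBy_x_y,
      KleinBottle.isPresentedBy_u_v, mapOfEq_injective_of_isCoveringMap hcov.isCoveringMap _,
      (ker_deckHom hcov _).symm, deckHom_surjective hcov _, Torus.mapOfEq_toKlein_x k,
      Torus.mapOfEq_toKlein_y k, Torus.deckHom_toKlein_u hk, Torus.deckHom_toKlein_v hk⟩,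
    Torus.not_hasBorsukUlam hk, Torus.toPlane, fun _ ha b _ => Torus.toPlane_pt ha b,
    Torus.injOn_toPlane_orbit hk⟩
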